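/- A pair $(G,\mathcal P)$ of a group $G$ and a collection $\mathcal P$ of subgroups of $G$ is called relatively hyperbolic if $G$ acts properly discontinuously by isometries on a proper geodesic Gromov-hyperbolic metric space $X$ such that every point of $\partial X$ is a conical limit point or a bounded parabolic point and $\mathcal P$ is exactly the collection of maximal parabolic subgroups (the stabilizers of the parabolic points); the members of $\mathcal P$ are called peripheral subgroups. **Theorem.** Let $(G,\mathcal P)$ be a relatively hyperbolic group pair such that $G$ is the fundamental group of a finite connected graph of groups in which every edge group is finite and every vertex group is either finite or (a conjugate in $G$ of) a peripheral subgroup. Assume that every $P\in\mathcal P$ is residually finite. Then $G$ is virtually the free product of a free group and finite-index subgroups of peripheral subgroups. That is, there are a finite-index subgroup $H\le G$, integers $r,n\ge 0$, elements $x_1,\dots,x_r\in G$, subgroups $P_1,\dots,P_n\in\mathcal P$, finite-index subgroups $Q_i\le P_i$ and elements $g_1,\dots,g_n\in G$ such that the canonical homomorphism $$F_r * Q_1*\cdots * Q_n\to G,$$ which sends the $j$-th free generator to $x_j$ and $q\in Q_i$ to $g_iqg_i^{-1}$, is injective with image $H$. -/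

import Mathlib

open scoped NNReal Topology

/-! ## Hyperbolic spaces and their boundary -/

namespace RelHyp

section Space

variable (X : Type*) [MetricSpace X]

/-- Any two points are joined by a geodesic segment. -/
def IsGeodesicSpace : Prop :=
  ∀ x y : X, ∃ γ : Set.Icc (0 : ℝ) (dist x y) → X, Isometry γ ∧
    γ ⟨0, le_rfl, dist_nonneg⟩ = x ∧ γ ⟨dist x y, dist_nonneg, le_rfl⟩ = y

variable {X} in
/-- The Gromov product of `x` and `y` at the base point `w`. -/
noncomputable def gromovProduct (w x y : X) : ℝ :=
  (dist x w + dist y w - dist x y) / 2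

/-- Gromov hyperbolicity, by the four-point condition. -/
def IsGromovHyperbolic : Prop :=
  ∃ δ : ℝ, ∀ w x y z : X,
    min (gromovProduct w x y) (gromovProduct w y z) - δ ≤ gromovProduct w x z

/-- Geodesic rays. As a subtype of a product it carries the topology of pointwise convergence, which
is the topology of uniform convergence on compact sets, the maps being isometric embeddings. -/
abbrev GeodesicRay : Type _ := {r : ℝ≥0 → X // Isometry r}

/-- Two rays are asymptotic if they stay at bounded distance from one another. -/
def asymptotic : Setoid (GeodesicRay X) where
  r r s := ∃ C : ℝ, ∀ t, dist (r.1 t) (s.1 t) ≤ C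
  iseqv :=
    { refl := fun r => ⟨0, fun t => (dist_self (r.1 t)).le⟩
      symm := fun ⟨C, h⟩ => ⟨C, fun t => by rw [dist_comm]; exact h t⟩
      trans := fun ⟨C, h⟩ ⟨D, k⟩ =>
        ⟨C + D, fun t => (dist_triangle _ _ _).trans (add_le_add (h t) (k t))⟩ }

/-- The boundary at infinity: asymptotic classes of geodesic rays, with the quotient topology. -/
def Boundary : Type _ := Quotient (asymptotic X)

instance : TopologicalSpace (Boundary X) :=
  inferInstanceAs (TopologicalSpace (Quotient (asymptotic X)))

end Space

section Action

variable (G : Type*) [Group G] {X : Type*} [MetricSpace X] [MulAction G X] [IsIsometricSMul G X]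

/-- A group acting by isometries acts on the boundary by translating rays. -/
instance : MulAction G (Boundary X) where
  smul g := Quotient.map
    (fun r => (⟨fun t => g • r.1 t, (isometry_smul X g).comp r.2⟩ : GeodesicRay X))
    (fun _ _ ⟨C, h⟩ => ⟨C, fun t => by simpa only [dist_smul] using h t⟩)
  one_smul y := by
    induction y using Quotient.inductionOn with
    | h r => exact congrArg (Quotient.mk (asymptotic X)) (Subtype.ext (funext fun t => one_smul G _))
  mul_smul g h y := by
    induction y using Quotient.inductionOn with
    | h r => exact congrArg (Quotient.mk (asymptotic X)) (Subtype.ext (funext fun t => mul_smul g h _))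

/-- `y` is a conical limit point. -/
def IsConicalLimitPoint (y : Boundary X) : Prop :=
  ∃ (g : ℕ → G) (a b : Boundary X), a ≠ b ∧
    Filter.Tendsto (fun i => g i • y) Filter.atTop (𝓝 a) ∧
    ∀ z, z ≠ y → Filter.Tendsto (fun i => g i • z) Filter.atTop (𝓝 b)

/-- `y` is a parabolic point: its stabilizer is infinite and fixes no other point. -/
def IsParabolicPoint (y : Boundary X) : Prop :=
  Infinite (MulAction.stabilizer G y) ∧
    ∀ z : Boundary X, (∀ g ∈ MulAction.stabilizer G y, g • z = z) → z = y

/-- The orbit relation of the stabilizer of `y` on the complement of `y`. -/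
def complementOrbitRel (y : Boundary X) : Setoid {z : Boundary X // z ≠ y} where
  r z w := ∃ g ∈ MulAction.stabilizer G y, g • z.1 = w.1
  iseqv :=
    { refl := fun z => ⟨1, one_mem _, one_smul G z.1⟩
      symm := fun ⟨g, hg, h⟩ => ⟨g⁻¹, inv_mem hg, by rw [← h, inv_smul_smul]⟩
      trans := fun ⟨g, hg, h⟩ ⟨k, hk, h'⟩ => ⟨k * g, mul_mem hk hg, by rw [mul_smul, h, h']⟩ }

/-- `y` is a bounded parabolic point: its stabilizer acts cocompactly on the complement of `y`. -/
def IsBoundedParabolicPoint (y : Boundary X) : Prop :=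
  IsParabolicPoint G y ∧ CompactSpace (Quotient (complementOrbitRel G y))

end Action

/-- `(G, Ps)` is a relatively hyperbolic group pair: `G` acts properly discontinuously by isometries
on a proper geodesic hyperbolic space, every boundary point is a conical limit point or a bounded
parabolic point, and `Ps` is exactly the collection of the maximal parabolic subgroups, that is, of
the stabilizers of parabolic points. (A proper metric space has at most the cardinality of the
continuum, so letting `X` range over `Type` is no restriction.) -/
def IsRelativelyHyperbolic (G : Type*) [Group G] (Ps : Set (Subgroup G)) : Prop :=
  ∃ (X : Type) (_ : MetricSpace X) (_ : ProperSpace X) (_ : Nonempty X) (_ : MulAction G X)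
    (_ : IsIsometricSMul G X) (_ : ProperlyDiscontinuousSMul G X),
    IsGeodesicSpace X ∧ IsGromovHyperbolic X ∧
    (∀ y : Boundary X, IsConicalLimitPoint G y ∨ IsBoundedParabolicPoint G y) ∧
    ∀ P : Subgroup G, P ∈ Ps ↔
      ∃ y : Boundary X, IsParabolicPoint G y ∧ P = MulAction.stabilizer G y

end RelHyp

/-! ## Graphs of groups -/

/-- A graph of groups on a graph (loops and multiple edges allowed) with vertex set `V` and edge
set `E`, every edge being given with one of its two orientations. -/
structure GraphOfGroups (V : Type*) (E : Type*) where
  /-- the initial vertex of an edge -/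
  src : E → V
  /-- the terminal vertex of an edge -/
  tgt : E → V
  /-- the vertex groups -/
  vertexGroup : V → Type*
  /-- the edge groups -/
  edgeGroup : E → Type*
  [instVertexGroup : ∀ v, Group (vertexGroup v)]
  [instEdgeGroup : ∀ e, Group (edgeGroup e)]
  /-- the edge map into the group of the initial vertex -/
  φ₀ : ∀ e, edgeGroup e →* vertexGroup (src e)
  /-- the edge map into the group of the terminal vertex -/
  φ₁ : ∀ e, edgeGroup e →* vertexGroup (tgt e)
  φ₀_injective : ∀ e, Function.Injective (φ₀ e)
  φ₁_injective : ∀ e, Function.Injective (φ₁ e)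

namespace GraphOfGroups

attribute [instance] instVertexGroup instEdgeGroup

variable {V E : Type*} (𝒢 : GraphOfGroups V E)

/-- Any two vertices are joined by an unoriented path with edges in `T`. -/
def Connects (T : Set E) : Prop :=
  ∀ u v : V, Relation.EqvGen (fun a b => ∃ e ∈ T, 𝒢.src e = a ∧ 𝒢.tgt e = b) u v

/-- `T` is the edge set of a maximal tree of the underlying graph: `T` connects all vertices, and no
proper subset of `T` does. (There is such a `T` only if the graph is connected.) -/
def IsMaximalTree (T : Set E) : Prop := Minimal 𝒢.Connects T

/-- The free product of all vertex groups and of the free group on the letters `t e`. -/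
abbrev Generators : Type _ := Monoid.Coprod (Monoid.CoprodI 𝒢.vertexGroup) (FreeGroup E)

/-- The inclusion of a vertex group. -/
def ofVertex (v : V) : 𝒢.vertexGroup v →* 𝒢.Generators :=
  Monoid.Coprod.inl.comp Monoid.CoprodI.of

/-- The stable letter of an edge. -/
def t (e : E) : 𝒢.Generators := Monoid.Coprod.inr (FreeGroup.of e)

/-- The relators `t e * φ₀ x * (t e)⁻¹ * (φ₁ x)⁻¹`, and `t e` for `e` in the maximal tree. -/
def relators (T : Set E) : Set 𝒢.Generators :=
  {w | ∃ (e : E) (x : 𝒢.edgeGroup e),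
      w = 𝒢.t e * 𝒢.ofVertex _ (𝒢.φ₀ e x) * (𝒢.t e)⁻¹ * (𝒢.ofVertex _ (𝒢.φ₁ e x))⁻¹} ∪
  {w | ∃ e ∈ T, w = 𝒢.t e}

/-- The fundamental group of the graph of groups with respect to the maximal tree `T`. -/
abbrev FundamentalGroup (T : Set E) : Type _ :=
  𝒢.Generators ⧸ Subgroup.normalClosure (𝒢.relators T)

/-- The canonical map from a vertex group to the fundamental group. -/
def vertexHom (T : Set E) (v : V) : 𝒢.vertexGroup v →* 𝒢.FundamentalGroup T :=
  (QuotientGroup.mk' _).comp (𝒢.ofVertex v)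

end GraphOfGroups

/-! ## Free products inside a group -/

/-- Given elements `x j` of `G`, subgroups `Q i` of subgroups `P i` of `G`, and elements `g i` of
`G`, the canonical map from the free product of the free group on the `x j` and the groups `Q i` to
`G`, which sends `q` in `Q i` to `g i * q * (g i)⁻¹`. -/
def freeProductMap {G : Type*} [Group G] {r n : ℕ} (x : Fin r → G) (P : Fin n → Subgroup G)
    (Q : ∀ i, Subgroup (P i)) (g : Fin n → G) :
    Monoid.Coprod (FreeGroup (Fin r)) (Monoid.CoprodI fun i => Q i) →* G :=
  Monoid.Coprod.lift (FreeGroup.lift x)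
    (Monoid.CoprodI.lift fun i =>
      (MulAut.conj (g i)).toMonoidHom.comp ((P i).subtype.comp (Q i).subtype))

/-! ## Maximal trees -/

/-! Residual finiteness gives a finite-index normal subgroup `N` of `G` that meets every edge group
and every finite vertex group trivially. By Bass–Serre theory `N` is then the fundamental group of a
finite graph of groups with trivial edge groups, hence the free product of a free group (the
fundamental group of the quotient graph) and the vertex groups. These are intersections of `N` with
conjugates of the `D v`: trivial if `D v` is finite, otherwise of finite index in a conjugate of a
peripheral subgroup.

To construct `N` (`exists_normal_finiteIndex`), choose finite quotients of the vertex groups,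
injective on the relevant finite sets, and let every vertex group act by translation on their
product `W`. The two resulting actions of an edge group on `W` are free, hence isomorphic
(`exists_perm_intertwining`). After conjugation the actions fit together to a homomorphism `G → Perm
W`, and `N` is its kernel.

The structure of `N` is obtained without the Bass–Serre tree or normal forms. Let `G` act on `X = G
⧸ N`, where edge groups act freely, let `K` be the abstract free product, and let `Φ : K → G` be the
canonical map. The universal property of `G`, applied with target `(X → K) ⋊ G`, gives a cocycle `C
: G → X → K` (`exists_cocycle`). On generators, `k ↦ C (Φ k) x₀` is conjugation by a fixed element,
so `Φ` is injective; and `Φ (C g x)` is `g` up to a coboundary, so the range of `Φ` is the whole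
stabilizer of `x₀` (`injective_and_range_eq_stabilizer`). -/

namespace Multigraph

variable {V E : Type*}

/-- Any two vertices are joined by an unoriented path with edges in `T`. -/
def Connects (src tgt : E → V) (T : Set E) : Prop :=
  ∀ u v : V, Relation.EqvGen (fun a b => ∃ e ∈ T, src e = a ∧ tgt e = b) u v

theorem Connects.eq_of_forall {src tgt : E → V} {T : Set E} (h : Connects src tgt T)
    {α : Type*} {f : V → α} (hf : ∀ e ∈ T, f (src e) = f (tgt e)) (u v : V) : f u = f v := by
  induction h u v with
  | rel a b hab => obtain ⟨e, he, rfl, rfl⟩ := hab; exact hf e he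
  | refl a => rfl
  | symm a b _ ih => exact ih.symm
  | trans a b c _ _ ih₁ ih₂ => exact ih₁.trans ih₂

/-- Otherwise each passage through `e` could be replaced by a detour, and `T \ {e}` would still
connect all vertices. -/
theorem not_eqvGen_of_minimal {src tgt : E → V} {T : Set E} (hT : Minimal (Connects src tgt) T)
    {e : E} (he : e ∈ T) :
    ¬ Relation.EqvGen (fun a b => ∃ e' ∈ T \ {e}, src e' = a ∧ tgt e' = b) (src e) (tgt e) := by
  intro h
  have hc : Connects src tgt (T \ {e}) := by
    intro u v
    induction hT.prop u v with
    | rel a b hab =>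
      obtain ⟨e', he', rfl, rfl⟩ := hab
      by_cases hee : e' = e
      · rw [hee]; exact h
      · exact .rel _ _ ⟨e', ⟨he', hee⟩, rfl, rfl⟩
    | refl a => exact .refl a
    | symm a b _ ih => exact .symm _ _ ih
    | trans a b c _ _ ih₁ ih₂ => exact .trans _ _ _ ih₁ ih₂
  exact (hT.le_of_le hc Set.sdiff_subset he).2 rfl

/-- On a maximal tree every cochain with values in a group is a coboundary. -/
theorem exists_potential [Finite E] {src tgt : E → V} {T : Set E}
    (hT : Minimal (Connects src tgt) T) {K : Type*} [Group K] (m : E → K) :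
    ∃ p : V → K, ∀ e ∈ T, p (tgt e) = m e * p (src e) := by
  classical
  suffices H : ∀ S : Set E, S.Finite → S ⊆ T → ∃ p : V → K, ∀ e ∈ S, p (tgt e) = m e * p (src e) from
    H T (Set.toFinite T) subset_rfl
  intro S hS
  induction S, hS using Set.Finite.induction_on with
  | empty => exact fun _ => ⟨fun _ => 1, by simp⟩
  | @insert e S heS _ ih =>
    intro hST
    obtain ⟨p, hp⟩ := ih ((Set.subset_insert _ _).trans hST)
    let R := fun a b => ∃ e' ∈ S, src e' = a ∧ tgt e' = b
    have hsep : ¬ Relation.EqvGen R (src e) (tgt e) := fun h =>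
      not_eqvGen_of_minimal hT (hST (Set.mem_insert _ _)) (Relation.EqvGen.mono
        (fun a b ⟨e', he', hab⟩ => ⟨e', ⟨hST (Set.mem_insert_of_mem _ he'),
          fun h => heS (Set.mem_singleton_iff.1 h ▸ he')⟩, hab⟩) _ _ h)
    -- Right multiplication of `p` by a constant on one component of the forest `S` preserves the
    -- equations along `S`. The constant `z` is the one that makes the equation along the new edge
    -- `e` true.
    let z := (p (tgt e))⁻¹ * m e * p (src e)
    refine ⟨fun v => if Relation.EqvGen R (tgt e) v then p v * z else p v, ?_⟩
    rintro e' (rfl | he')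
    · have h1 : ¬ Relation.EqvGen R (tgt e') (src e') := fun h => hsep (.symm _ _ h)
      simp only [if_pos (Relation.EqvGen.refl (r := R) (tgt e')), if_neg h1, z]
      group
    · have hR : Relation.EqvGen R (src e') (tgt e') := .rel _ _ ⟨e', he', rfl, rfl⟩
      have hiff : Relation.EqvGen R (tgt e) (src e') ↔ Relation.EqvGen R (tgt e) (tgt e') :=
        ⟨fun h => .trans _ _ _ h hR, fun h => .trans _ _ _ h (.symm _ _ hR)⟩
      by_cases h : Relation.EqvGen R (tgt e) (tgt e')
      · simp only [if_pos h, if_pos (hiff.2 h), hp e' he', mul_assoc]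
      · simp only [if_neg h, if_neg (mt hiff.1 h), hp e' he']

theorem exists_minimal_connects [Finite E] {src tgt : E → V} (h : Connects src tgt Set.univ) :
    ∃ T, Minimal (Connects src tgt) T := by
  obtain ⟨T, -, hT⟩ := exists_minimal_le_of_wellFoundedLT (Connects src tgt) _ h
  exact ⟨T, hT⟩

end Multigraph

/-! ## Graphs of groups seen inside their fundamental group -/

/-- The subgroups and elements of a group that come from an identification of it with the
fundamental group of a graph of groups. -/
structure GraphDecomposition (G : Type*) [Group G] (V E : Type*) where
  /-- the initial vertex of an edge -/
  src : E → V
  /-- the terminal vertex of an edge -/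
  tgt : E → V
  /-- the images of the vertex groups -/
  D : V → Subgroup G
  /-- the images of the edge groups under the inclusion at the initial vertex -/
  A : E → Subgroup G
  /-- the stable letters -/
  t : E → G
  /-- a maximal tree -/
  T : Set E
  minimal : Minimal (Multigraph.Connects src tgt) T
  A_le : ∀ e, A e ≤ D (src e)
  conj_mem : ∀ {e a}, a ∈ A e → t e * a * (t e)⁻¹ ∈ D (tgt e)
  t_eq_one : ∀ e ∈ T, t e = 1
  closure_eq_top : Subgroup.closure ((⋃ v, (D v : Set G)) ∪ Set.range t) = ⊤

namespace GraphDecomposition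

variable {G : Type*} [Group G] {V E : Type*}

/-- The universal property of the fundamental group, for targets in a given universe. -/
def HasLift.{w, u₁, u₂, u₃} {G : Type u₁} [Group G] {V : Type u₂} {E : Type u₃}
    (S : GraphDecomposition G V E) : Prop :=
  ∀ (L : Type w) [Group L] (f : ∀ v, S.D v →* L) (s : E → L),
    (∀ e a (ha : a ∈ S.A e), s e * f (S.src e) ⟨a, S.A_le e ha⟩ * (s e)⁻¹ =
      f (S.tgt e) ⟨S.t e * a * (S.t e)⁻¹, S.conj_mem ha⟩) →
    (∀ e ∈ S.T, s e = 1) →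
    ∃ F : G →* L, (∀ v (d : S.D v), F d = f v d) ∧ ∀ e, F (S.t e) = s e

theorem induction_on (S : GraphDecomposition G V E) {p : G → Prop} (g : G)
    (hD : ∀ v, ∀ d ∈ S.D v, p d) (ht : ∀ e, p (S.t e)) (hone : p 1)
    (hmul : ∀ g h, p g → p h → p (g * h)) (hinv : ∀ g, p g → p g⁻¹) : p g := by
  have hg : g ∈ Subgroup.closure ((⋃ v, (S.D v : Set G)) ∪ Set.range S.t) := by
    rw [S.closure_eq_top]; trivial
  induction hg using Subgroup.closure_induction with
  | mem x hx =>
    rcases hx with hx | ⟨e, rfl⟩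
    · obtain ⟨v, hv⟩ := Set.mem_iUnion.1 hx
      exact hD v x hv
    · exact ht e
  | one => exact hone
  | mul x y _ _ hx hy => exact hmul x y hx hy
  | inv x _ hx => exact hinv x hx

/-- Cocycles on the vertex groups and functions on the edges, subject to the defining relations,
come from a cocycle on the whole group. -/
theorem exists_cocycle.{u₁, u₂, u₃} {G : Type u₁} [Group G] (S : GraphDecomposition G V E)
    {X : Type u₂} [MulAction G X] {K : Type u₃} [Group K]
    (hS : HasLift.{max u₁ u₂ u₃} S) (c : V → G → X → K) (m : E → X → K)
    (hc : ∀ v, ∀ g ∈ S.D v, ∀ h ∈ S.D v, ∀ x, c v (g * h) x = c v g (h • x) * c v h x)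
    (hm : ∀ e, ∀ a ∈ S.A e, ∀ x,
      c (S.tgt e) (S.t e * a * (S.t e)⁻¹) (S.t e • x) * m e x = m e (a • x) * c (S.src e) a x)
    (hT : ∀ e ∈ S.T, ∀ x, m e x = 1) :
    ∃ C : G → X → K, (∀ g h x, C (g * h) x = C g (h • x) * C h x) ∧
      (∀ v, ∀ d ∈ S.D v, ∀ x, C d x = c v d x) ∧ ∀ e x, C (S.t e) x = m e x := by
  have hsmul : ∀ (g : G) (φ : X → K) (x : X), mulAutArrow g φ x = φ (g⁻¹ • x) :=
    fun _ _ _ => rfl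
  -- A cocycle is the same as a homomorphic section of `(X → K) ⋊ G → G`. The function component of
  -- the image of `g` takes the value of the cocycle at `g`, `x` in the point `g • x`, whence the
  -- inverses.
  let f : ∀ v, S.D v →* (X → K) ⋊[mulAutArrow] G := fun v => MonoidHom.mk'
    (fun d => ⟨fun x => c v d ((d : G)⁻¹ • x), d⟩) (by
      intro g h
      ext x
      · simp [hc v g g.2 h h.2, mul_smul, hsmul, -mulAutArrow_apply_apply]
      · simp)
  let s : E → (X → K) ⋊[mulAutArrow] G := fun e => ⟨fun x => m e ((S.t e)⁻¹ • x), S.t e⟩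
  obtain ⟨F, hF, hFt⟩ := hS _ f s (by
    intro e a ha
    rw [mul_inv_eq_iff_eq_mul]
    ext x
    · have := hm e a ha (a⁻¹ • (S.t e)⁻¹ • x)
      simp only [smul_inv_smul] at this
      simp only [f, s, MonoidHom.mk'_apply, SemidirectProduct.mul_left, Pi.mul_apply, hsmul,
        mul_inv_rev, inv_inv, mul_smul, inv_smul_smul, this]
    · simp [f, s]) (by
    intro e he
    ext x
    · simp [s, hT e he]
    · simp [s, S.t_eq_one e he])
  have hright : ∀ g, (F g).right = g := by
    intro g
    induction g using S.induction_on with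
    | hD v d hd => rw [hF v ⟨d, hd⟩]; rfl
    | ht e => rw [hFt]
    | hone => simp
    | hmul g h hg hh => simp [hg, hh]
    | hinv g hg => simp [hg]
  refine ⟨fun g x => (F g).left (g • x), ?_, ?_, ?_⟩
  · intro g h x
    simp [hright, mul_smul, hsmul, -mulAutArrow_apply_apply]
  · intro v d hd x
    simp [hF v ⟨d, hd⟩, f]
  · intro e x
    simp [hFt, s]

end GraphDecomposition

/-! ## Orbit representatives and transversals -/

section Orbits

variable {G X : Type*} [Group G] [MulAction G X] (B : Subgroup G)

/-- A chosen representative of the orbit of `x` under `B`. -/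
noncomputable def orbitRep (x : X) : X := (Quotient.mk (MulAction.orbitRel B X) x).out

theorem exists_smul_orbitRep (x : X) : ∃ b ∈ B, b • orbitRep B x = x := by
  obtain ⟨b, hb⟩ := (Quotient.mk_out (s := MulAction.orbitRel B X) x)
  refine ⟨(b : G)⁻¹, inv_mem b.2, ?_⟩
  rw [inv_smul_eq_iff]
  exact hb.symm

theorem orbitRep_smul {b : G} (hb : b ∈ B) (x : X) : orbitRep B (b • x) = orbitRep B x := by
  unfold orbitRep
  congr 1
  exact Quotient.sound (s := MulAction.orbitRel B X) ⟨⟨b, hb⟩, rfl⟩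

theorem orbitRep_orbitRep (x : X) : orbitRep B (orbitRep B x) = orbitRep B x := by
  obtain ⟨b, hb, h⟩ := exists_smul_orbitRep B x
  conv_rhs => rw [← h, orbitRep_smul B hb]

open Classical in
/-- An element of `B` moving the orbit representative of `x` to `x`, trivial at representatives. -/
noncomputable def orbitSection (x : X) : G :=
  if orbitRep B x = x then 1 else (exists_smul_orbitRep B x).choose

theorem orbitSection_mem (x : X) : orbitSection B x ∈ B := by
  unfold orbitSection
  split_ifs
  · exact one_mem _
  · exact (exists_smul_orbitRep B x).choose_spec.1

theorem orbitSection_smul (x : X) : orbitSection B x • orbitRep B x = x := by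
  unfold orbitSection
  split_ifs with h
  · rw [one_smul, h]
  · exact (exists_smul_orbitRep B x).choose_spec.2

theorem orbitSection_eq_one {x : X} (h : orbitRep B x = x) : orbitSection B x = 1 := if_pos h

theorem orbitSection_inv_smul (x : X) : (orbitSection B x)⁻¹ • x = orbitRep B x := by
  rw [inv_smul_eq_iff, orbitSection_smul]

end Orbits

/-! ### The quotient graph of the action and a maximal tree in it -/

namespace GraphDecomposition

variable {G : Type*} [Group G] {V E : Type*} (S : GraphDecomposition G V E)
  {X : Type*} [MulAction G X]

/-- The element which carries, along the edge `e` at `x`, the orbit representative at the initial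
vertex to that at the terminal vertex. -/
noncomputable def edgeElement (e : E) (x : X) : G :=
  (orbitSection (S.D (S.tgt e)) (S.t e • x))⁻¹ * S.t e * orbitSection (S.D (S.src e)) x

theorem edgeElement_smul (e : E) (x : X) :
    S.edgeElement e x • orbitRep (S.D (S.src e)) x = orbitRep (S.D (S.tgt e)) (S.t e • x) := by
  rw [edgeElement, mul_smul, mul_smul, orbitSection_smul, orbitSection_inv_smul]

/-- The quotient of the Bass-Serre graph is connected, and a maximal tree in it provides compatible
elements moving a base point to all orbit representatives. -/
theorem exists_quotient_tree [Finite E] [Finite X] [Nonempty V] [MulAction.IsPretransitive G X]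
    [Nonempty X] :
    ∃ (T' : Set (E × X)) (β : V → X → G) (x₀ : X),
      (∀ v x, orbitRep (S.D v) x = x → β v x • x₀ = x) ∧
      (∀ e x, (e, x) ∈ T' → β (S.tgt e) (orbitRep (S.D (S.tgt e)) (S.t e • x)) =
        S.edgeElement e x * β (S.src e) (orbitRep (S.D (S.src e)) x)) ∧
      ∀ p : V → X → Prop,
        (∀ e x, (e, x) ∈ T' → orbitRep (S.A e) x = x →
          (p (S.src e) (orbitRep (S.D (S.src e)) x) ↔
            p (S.tgt e) (orbitRep (S.D (S.tgt e)) (S.t e • x)))) →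
        ∀ v x v' x', orbitRep (S.D v) x = x → orbitRep (S.D v') x' = x' → p v x → p v' x' := by
  -- Vertices and edges of the quotient graph are the orbits of the `D v` and of the `A e` on `X`,
  -- given by their representatives.
  let VΓ := {y : V × X // orbitRep (S.D y.1) y.2 = y.2}
  let EΓ := {y : E × X // orbitRep (S.A y.1) y.2 = y.2}
  let vt : V → X → VΓ := fun v x => ⟨(v, orbitRep (S.D v) x), orbitRep_orbitRep _ _⟩
  have hvt : ∀ v x (h : orbitRep (S.D v) x = x), vt v x = ⟨(v, x), h⟩ :=
    fun v x h => Subtype.ext (Prod.ext rfl h)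
  let src : EΓ → VΓ := fun ε => vt (S.src ε.1.1) ε.1.2
  let tgt : EΓ → VΓ := fun ε => vt (S.tgt ε.1.1) (S.t ε.1.1 • ε.1.2)
  let R : VΓ → VΓ → Prop :=
    Relation.EqvGen fun a b => ∃ ε ∈ (Set.univ : Set EΓ), src ε = a ∧ tgt ε = b
  have hvertex : ∀ v x d, d ∈ S.D v → vt v (d • x) = vt v x := fun v x d hd =>
    Subtype.ext (Prod.ext rfl (orbitRep_smul _ hd _))
  have hedge : ∀ e x, R (vt (S.src e) x) (vt (S.tgt e) (S.t e • x)) := by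
    intro e x
    obtain ⟨a, ha, hax⟩ := exists_smul_orbitRep (S.A e) x
    have h1 : vt (S.src e) x = vt (S.src e) (orbitRep (S.A e) x) := by
      conv_lhs => rw [← hax]
      exact hvertex _ _ _ (S.A_le e ha)
    have h2 : vt (S.tgt e) (S.t e • x) = vt (S.tgt e) (S.t e • orbitRep (S.A e) x) := by
      rw [← hvertex (S.tgt e) (S.t e • orbitRep (S.A e) x) _ (S.conj_mem ha)]
      simp only [mul_smul, inv_smul_smul, hax]
    rw [h1, h2]
    exact .rel _ _ ⟨⟨(e, orbitRep (S.A e) x), orbitRep_orbitRep _ _⟩, trivial, rfl, rfl⟩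
  have hV : ∀ x v v', R (vt v x) (vt v' x) := by
    intro x v v'
    induction S.minimal.prop v v' with
    | rel a b hab =>
      obtain ⟨e, he, rfl, rfl⟩ := hab
      simpa [S.t_eq_one e he] using hedge e x
    | refl a => exact .refl _
    | symm a b _ ih => exact .symm _ _ ih
    | trans a b c _ _ ih₁ ih₂ => exact .trans _ _ _ ih₁ ih₂
  have hG : ∀ g : G, ∀ x v v', R (vt v x) (vt v' (g • x)) := by
    intro g
    induction g using S.induction_on with
    | hD w d hd =>
      intro x v v'
      refine .trans _ _ _ (hV x v w) ?_
      rw [← hvertex w x d hd]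
      exact hV _ _ _
    | ht e =>
      exact fun x v v' => .trans _ _ _ (hV x v (S.src e)) (.trans _ _ _ (hedge e x) (hV _ _ _))
    | hone => exact fun x v v' => by rw [one_smul]; exact hV x v v'
    | hmul g h hg hh =>
      intro x v v'
      rw [mul_smul]
      exact .trans _ _ _ (hh x v v) (hg _ v v')
    | hinv g hg =>
      intro x v v'
      have := hg (g⁻¹ • x) v' v
      rw [smul_inv_smul] at this
      exact .symm _ _ this
  have hconn : Multigraph.Connects src tgt Set.univ := by
    rintro ⟨⟨v, x⟩, hx⟩ ⟨⟨v', x'⟩, hx'⟩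
    obtain ⟨g, rfl⟩ := MulAction.exists_smul_eq G x x'
    have := hG g x v v'
    rwa [hvt v x hx, hvt v' _ hx'] at this
  obtain ⟨T', hT'⟩ := Multigraph.exists_minimal_connects hconn
  obtain ⟨β, hβ⟩ := Multigraph.exists_potential hT' fun ε => S.edgeElement ε.1.1 ε.1.2
  -- The potential equation for `β` says exactly that `(β y)⁻¹ • y.1.2` does not change along tree
  -- edges; its common value is the base point.
  have hbase := hT'.prop.eq_of_forall (f := fun y => (β y)⁻¹ • y.1.2) (by
    intro ε hε
    rw [hβ ε hε]
    simp only [mul_inv_rev, mul_smul]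
    congr 1
    rw [eq_inv_smul_iff]
    exact S.edgeElement_smul _ _)
  obtain ⟨v₀⟩ := ‹Nonempty V›
  obtain ⟨x₁⟩ := ‹Nonempty X›
  refine ⟨{y | ∃ ε ∈ T', ε.1 = y}, fun v x => β (vt v x), (β (vt v₀ x₁))⁻¹ • (vt v₀ x₁).1.2,
    ?_, ?_, ?_⟩
  · intro v x hx
    have := hbase (vt v₀ x₁) (vt v x)
    rw [this, smul_inv_smul]
    exact hx
  · rintro e x ⟨ε, hε, hεx⟩
    have h := hβ ε hε
    obtain ⟨⟨e', x'⟩, hx'⟩ := ε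
    obtain ⟨rfl, rfl⟩ := Prod.mk.inj hεx
    beta_reduce
    rw [hvt _ _ (orbitRep_orbitRep _ _), hvt _ _ (orbitRep_orbitRep _ _)]
    exact h
  · intro p hp v x v' x' hx hx' h
    have := hT'.prop.eq_of_forall (f := fun y => p y.1.1 y.1.2) (by
      intro ε hε
      exact propext (hp ε.1.1 ε.1.2 ⟨ε, hε, rfl⟩ ε.2))
    exact (this ⟨(v, x), hx⟩ ⟨(v', x'), hx'⟩).mp h

end GraphDecomposition

/-! ### Point stabilizers when the edge groups act freely -/

namespace GraphDecomposition

/-- The structure theorem for the stabilizer of a point: let `G` act on `X` such that the edge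
groups act freely. A group `K` generated by copies of the stabilizers in the vertex groups of orbit
representatives, and by elements for the edges outside a maximal tree of the quotient graph, maps
isomorphically onto the stabilizer of the base point. -/
theorem injective_and_range_eq_stabilizer.{u₁, u₂, u₃, u₄, u₅} {G : Type u₁} [Group G]
    {V : Type u₄} {E : Type u₅} [Finite E] [Nonempty V] (S : GraphDecomposition G V E)
    {X : Type u₂} [MulAction G X]
    {K : Type u₃} [Group K] (hS : HasLift.{max u₁ u₂ u₃} S)
    (hfree : ∀ e, ∀ a ∈ S.A e, ∀ x : X, a • x = x → a = 1)
    {T' : Set (E × X)} {β : V → X → G} {x₀ : X}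
    (hβ : ∀ v x, orbitRep (S.D v) x = x → β v x • x₀ = x)
    (hβT : ∀ e x, (e, x) ∈ T' → β (S.tgt e) (orbitRep (S.D (S.tgt e)) (S.t e • x)) =
        S.edgeElement e x * β (S.src e) (orbitRep (S.D (S.src e)) x))
    (hconn : ∀ p : V → X → Prop,
        (∀ e x, (e, x) ∈ T' → orbitRep (S.A e) x = x →
          (p (S.src e) (orbitRep (S.D (S.src e)) x) ↔
            p (S.tgt e) (orbitRep (S.D (S.tgt e)) (S.t e • x)))) →
        ∀ v x v' x', orbitRep (S.D v) x = x → orbitRep (S.D v') x' = x' → p v x → p v' x')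
    (f : V → X → G → K) (n : E → X → K) (Φ : K →* G)
    (hf : ∀ v x, orbitRep (S.D v) x = x → ∀ g ∈ S.D v, g • x = x → ∀ h ∈ S.D v, h • x = x →
      f v x (g * h) = f v x g * f v x h)
    (hΦf : ∀ v x, orbitRep (S.D v) x = x → ∀ g ∈ S.D v, g • x = x →
      Φ (f v x g) = (β v x)⁻¹ * g * β v x)
    (hΦn : ∀ e x, orbitRep (S.A e) x = x → Φ (n e x) =
      (β (S.tgt e) (orbitRep (S.D (S.tgt e)) (S.t e • x)))⁻¹ * S.edgeElement e x *
        β (S.src e) (orbitRep (S.D (S.src e)) x))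
    (hn : ∀ e x, (e, x) ∈ T' → n e x = 1)
    (hgen : ∀ M : Subgroup K,
      (∀ v x, orbitRep (S.D v) x = x → ∀ g ∈ S.D v, g • x = x → f v x g ∈ M) →
      (∀ e x, orbitRep (S.A e) x = x → n e x ∈ M) → M = ⊤) :
    Function.Injective Φ ∧ Φ.range = MulAction.stabilizer G x₀ := by
  let rep : V → X → X := fun v x => orbitRep (S.D v) x
  let sg : V → X → G := fun v x => orbitSection (S.D v) x
  have rep_rep : ∀ v x, rep v (rep v x) = rep v x := fun v x => orbitRep_orbitRep _ _
  have rep_smul : ∀ v, ∀ g ∈ S.D v, ∀ x, rep v (g • x) = rep v x :=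
    fun v g hg x => orbitRep_smul _ hg x
  have sg_mem : ∀ v x, sg v x ∈ S.D v := fun v x => orbitSection_mem _ _
  have sg_smul : ∀ v x, sg v x • rep v x = x := fun v x => orbitSection_smul _ _
  have sg_rep : ∀ v x, rep v x = x → sg v x = 1 := fun v x h => orbitSection_eq_one _ h
  have hf_one : ∀ v x, orbitRep (S.D v) x = x → f v x 1 = 1 := by
    intro v x hx
    have := hf v x hx 1 (one_mem _) (one_smul _ _) 1 (one_mem _) (one_smul _ _)
    simpa using this
  -- the cocycle on the vertex groups
  let q : V → G → X → G := fun v g x => (sg v (g • x))⁻¹ * g * sg v x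
  have q_mem : ∀ v, ∀ g ∈ S.D v, ∀ x, q v g x ∈ S.D v := fun v g hg x =>
    mul_mem (mul_mem (inv_mem (sg_mem _ _)) hg) (sg_mem _ _)
  have q_smul : ∀ v, ∀ g ∈ S.D v, ∀ x, q v g x • rep v x = rep v x := by
    intro v g hg x
    simp only [q, mul_smul, sg_smul]
    rw [inv_smul_eq_iff, ← rep_smul v g hg x, sg_smul]
  let c' : V → G → X → K := fun v g x => f v (rep v x) (q v g x)
  have c'_mul : ∀ v, ∀ g ∈ S.D v, ∀ h ∈ S.D v, ∀ x,
      c' v (g * h) x = c' v g (h • x) * c' v h x := by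
    intro v g hg h hh x
    have h1 : q v (g * h) x = q v g (h • x) * q v h x := by
      simp only [q, mul_smul]; group
    have h2 := q_smul v g hg (h • x)
    rw [rep_smul v h hh] at h2
    simp only [c', h1, rep_smul v h hh]
    exact hf v _ (rep_rep v x) _ (q_mem v g hg _) h2 _ (q_mem v h hh _) (q_smul v h hh _)
  have c'_one : ∀ v x, c' v 1 x = 1 := by
    intro v x
    have := c'_mul v 1 (one_mem _) 1 (one_mem _) x
    simpa using this
  have c'_sg : ∀ v x, c' v (sg v x) (rep v x) = 1 := by
    intro v x
    have h : q v (sg v x) (rep v x) = 1 := by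
      simp only [q, sg_smul, sg_rep v _ (rep_rep v x)]; group
    simp only [c', h]
    exact hf_one _ _ (by simp only [rep_rep]; exact rep_rep v x)
  -- its extension to the edges
  let a : E → X → G := fun e x => orbitSection (S.A e) x
  let re : E → X → X := fun e x => orbitRep (S.A e) x
  have a_mem : ∀ e x, a e x ∈ S.A e := fun e x => orbitSection_mem _ _
  have a_smul : ∀ e x, a e x • re e x = x := fun e x => orbitSection_smul _ _
  have re_smul : ∀ e, ∀ b ∈ S.A e, ∀ x, re e (b • x) = re e x :=
    fun e b hb x => orbitRep_smul _ hb x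
  -- Since the edge group acts freely, the element carrying the representative to a given point is
  -- unique, so the section is equivariant.
  have a_eq : ∀ e, ∀ b ∈ S.A e, ∀ x, a e (b • x) = b * a e x := by
    intro e b hb x
    refine (inv_mul_eq_one.1 (hfree e ((b * a e x)⁻¹ * a e (b • x))
      (mul_mem (inv_mem (mul_mem hb (a_mem _ _))) (a_mem _ _)) (re e x) ?_)).symm
    rw [mul_smul, inv_smul_eq_iff, mul_smul, a_smul]
    conv_lhs => rw [← re_smul e b hb x, a_smul]
  -- The compatibility `hm'` with the edge group forces this formula once the values `n e` at orbit
  -- representatives are prescribed.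
  let m' : E → X → K := fun e x =>
    c' (S.tgt e) (S.t e * a e x * (S.t e)⁻¹) (S.t e • re e x) * n e (re e x) *
      (c' (S.src e) (a e x) (re e x))⁻¹
  have hm' : ∀ e, ∀ b ∈ S.A e, ∀ x,
      c' (S.tgt e) (S.t e * b * (S.t e)⁻¹) (S.t e • x) * m' e x =
        m' e (b • x) * c' (S.src e) b x := by
    intro e b hb x
    have h1 : S.t e * (b * a e x) * (S.t e)⁻¹ =
        (S.t e * b * (S.t e)⁻¹) * (S.t e * a e x * (S.t e)⁻¹) := by group
    have h2 : (S.t e * a e x * (S.t e)⁻¹) • S.t e • re e x = S.t e • x := by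
      rw [mul_smul, mul_smul, inv_smul_smul, a_smul]
    simp only [m', a_eq e b hb, re_smul e b hb, h1]
    rw [c'_mul _ _ (S.conj_mem hb) _ (S.conj_mem (a_mem e x)), h2,
      c'_mul _ _ (S.A_le e hb) _ (S.A_le e (a_mem e x)), a_smul]
    group
  have m'_rep : ∀ e x, re e x = x → m' e x = n e x := by
    intro e x hx
    have h1 : a e x = 1 := orbitSection_eq_one _ hx
    simp only [m', h1, hx, mul_one, mul_inv_cancel, c'_one, one_mul, inv_one]
  -- The cochain `m'` need not be trivial on the maximal tree `T`, as the universal property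
  -- demands; twisting by the coboundary of a potential makes it so.
  choose p hp using fun x => Multigraph.exists_potential S.minimal fun e => m' e x
  obtain ⟨C, C_mul, C_D, C_t⟩ := S.exists_cocycle hS
    (fun v g x => (p (g • x) v)⁻¹ * c' v g x * p x v)
    (fun e x => (p (S.t e • x) (S.tgt e))⁻¹ * m' e x * p x (S.src e))
    (by
      intro v g hg h hh x
      simp only [c'_mul v g hg h hh, mul_smul]
      group)
    (by
      intro e b hb x
      have h := hm' e b hb x
      have h2 : (S.t e * b * (S.t e)⁻¹) • S.t e • x = S.t e • b • x := by
        rw [mul_smul, mul_smul, inv_smul_smul]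
      rw [h2]
      calc _ = (p (S.t e • b • x) (S.tgt e))⁻¹ *
            (c' (S.tgt e) (S.t e * b * (S.t e)⁻¹) (S.t e • x) * m' e x) * p x (S.src e) := by group
        _ = _ := by rw [h]; group)
    (by
      intro e he x
      rw [S.t_eq_one e he, one_smul, hp x e he]
      group)
  have C_inv : ∀ g x, C g⁻¹ (g • x) = (C g x)⁻¹ := by
    intro g x
    have h1 : C 1 x = 1 := by simpa using C_mul 1 1 x
    rw [eq_inv_iff_mul_eq_one, ← C_mul, inv_mul_cancel, h1]
  -- comparison with the map to `G`
  let α : V → X → G := fun v x => sg v x * β v (rep v x)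
  have hΦc' : ∀ v, ∀ g ∈ S.D v, ∀ x, Φ (c' v g x) = (α v (g • x))⁻¹ * g * α v x := by
    intro v g hg x
    simp only [c']
    rw [hΦf v _ (rep_rep v x) _ (q_mem v g hg x) (q_smul v g hg x)]
    simp only [q, α, rep_smul v g hg]
    group
  have hΦm' : ∀ e x, Φ (m' e x) = (α (S.tgt e) (S.t e • x))⁻¹ * S.t e * α (S.src e) x := by
    intro e x
    have h2 : (S.t e * a e x * (S.t e)⁻¹) • S.t e • re e x = S.t e • x := by
      rw [mul_smul, mul_smul, inv_smul_smul, a_smul]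
    simp only [m', map_mul, map_inv]
    rw [hΦc' _ _ (S.conj_mem (a_mem e x)), h2, hΦc' _ _ (S.A_le e (a_mem e x)), a_smul,
      hΦn e _ (orbitRep_orbitRep _ _)]
    simp only [α, edgeElement, rep, sg, re]
    group
  -- `Φ ∘ C` differs from the tautological cocycle `(g, x) ↦ g` by the coboundary of `τ`, which is
  -- independent of the vertex because tree letters are trivial.
  let τ : V → X → G := fun v x => α v x * Φ (p x v)
  have hτ : ∀ x v v', τ v x = τ v' x := by
    intro x
    refine S.minimal.prop.eq_of_forall fun e he => ?_
    simp only [τ, hp x e he, map_mul, hΦm', S.t_eq_one e he, one_smul]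
    group
  obtain ⟨v₀⟩ := ‹Nonempty V›
  have hΦC : ∀ g x, Φ (C g x) = (τ v₀ (g • x))⁻¹ * g * τ v₀ x := by
    intro g
    induction g using S.induction_on with
    | hD v d hd =>
      intro x
      rw [C_D v d hd, hτ _ v₀ v, hτ x v₀ v]
      simp only [map_mul, map_inv, hΦc' v d hd, τ]
      group
    | ht e =>
      intro x
      rw [C_t, hτ _ v₀ (S.tgt e), hτ x v₀ (S.src e)]
      simp only [map_mul, map_inv, hΦm', τ]
      group
    | hone =>
      intro x
      have h1 : C 1 x = 1 := by simpa using C_mul 1 1 x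
      rw [h1, one_smul, map_one]
      group
    | hmul g h hg hh =>
      intro x
      rw [C_mul, map_mul, hg, hh, mul_smul]
      group
    | hinv g hg =>
      intro x
      have h := C_inv g (g⁻¹ • x)
      rw [smul_inv_smul] at h
      rw [h, map_inv, hg, smul_inv_smul]
      group
  have hβ_inv : ∀ v x, orbitRep (S.D v) x = x → (β v x)⁻¹ • x = x₀ := by
    intro v x hx
    rw [inv_smul_eq_iff, hβ v x hx]
  have hstab : ∀ k, Φ k • x₀ = x₀ := by
    have h := hgen ((MulAction.stabilizer G x₀).comap Φ) (by
      intro v x hx g hg hgx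
      rw [Subgroup.mem_comap, MulAction.mem_stabilizer_iff, hΦf v x hx g hg hgx, mul_smul,
        mul_smul, hβ v x hx, hgx, hβ_inv v x hx]) (by
      intro e x hx
      rw [Subgroup.mem_comap, MulAction.mem_stabilizer_iff, hΦn e x hx, mul_smul,
        mul_smul, hβ _ _ (orbitRep_orbitRep _ _), S.edgeElement_smul,
        hβ_inv _ _ (orbitRep_orbitRep _ _)])
    intro k
    have hk : k ∈ (MulAction.stabilizer G x₀).comap Φ := by rw [h]; trivial
    exact hk
  constructor
  · -- the cocycle provides a left inverse up to conjugation
    have hsg : ∀ v x, C (sg v x) (rep v x) = (p x v)⁻¹ * p (rep v x) v := by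
      intro v x
      rw [C_D v _ (sg_mem v x), c'_sg, sg_smul, mul_one]
    have hedge : ∀ e x, orbitRep (S.A e) x = x → C (S.edgeElement e x) (rep (S.src e) x) =
        (p (rep (S.tgt e) (S.t e • x)) (S.tgt e))⁻¹ * n e x * p (rep (S.src e) x) (S.src e) := by
      intro e x hx
      have h1 := C_inv (sg (S.tgt e) (S.t e • x)) (rep (S.tgt e) (S.t e • x))
      rw [sg_smul, hsg] at h1
      rw [edgeElement, C_mul, C_mul]
      change C _ (S.t e • sg (S.src e) x • rep (S.src e) x) * C _ (sg (S.src e) x • _) *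
        C (sg (S.src e) x) _ = _
      rw [sg_smul, hsg, h1, C_t, m'_rep e x hx]
      group
    -- The conjugating element. It is the same at all vertices of the quotient graph: along an edge
    -- of `T'` both `n e x` and the corresponding loop in `G` are trivial.
    let θ : V → X → K := fun v x => p x v * C (β v x) x₀
    have hθedge : ∀ e x, orbitRep (S.A e) x = x →
        C ((β (S.tgt e) (rep (S.tgt e) (S.t e • x)))⁻¹ * S.edgeElement e x *
          β (S.src e) (rep (S.src e) x)) x₀ =
        (θ (S.tgt e) (rep (S.tgt e) (S.t e • x)))⁻¹ * n e x * θ (S.src e) (rep (S.src e) x) := by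
      intro e x hx
      have h1 := C_inv (β (S.tgt e) (rep (S.tgt e) (S.t e • x))) x₀
      rw [hβ _ _ (rep_rep _ _)] at h1
      rw [C_mul, C_mul, hβ _ _ (rep_rep _ _), hedge e x hx, S.edgeElement_smul, h1]
      simp only [θ]
      group
    let x₁ := rep v₀ x₀
    have hθ : ∀ v x, orbitRep (S.D v) x = x → θ v x = θ v₀ x₁ := by
      intro v x hx
      refine hconn (fun v x => θ v x = θ v₀ x₁) ?_ v₀ x₁ v x (rep_rep _ _) hx rfl
      intro e x hT hx
      have h := hθedge e x hx
      have h2 : (β (S.tgt e) (rep (S.tgt e) (S.t e • x)))⁻¹ * S.edgeElement e x *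
          β (S.src e) (rep (S.src e) x) = 1 := by
        rw [hβT e x hT]
        simp only [rep]
        group
      have h1 : C 1 x₀ = 1 := by simpa using C_mul 1 1 x₀
      rw [h2, h1, hn e x hT, mul_one, eq_comm, inv_mul_eq_one] at h
      simp only [rep] at h
      rw [h]
    -- Multiplicative because `Φ l` fixes `x₀`. Agreement with an inner automorphism need only be
    -- checked on generators.
    let Ψ : K →* K := MonoidHom.mk' (fun k => C (Φ k) x₀) (by
      intro k l
      rw [map_mul, C_mul, hstab])
    have hΨ := hgen (Ψ.eqLocus (MulAut.conj (θ v₀ x₁)⁻¹).toMonoidHom) (by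
      intro v x hx g hg hgx
      change C (Φ (f v x g)) x₀ = (θ v₀ x₁)⁻¹ * f v x g * (θ v₀ x₁)⁻¹⁻¹
      have h1 := C_inv (β v x) x₀
      rw [hβ v x hx] at h1
      rw [hΦf v x hx g hg hgx, C_mul, C_mul, hβ v x hx, hgx, h1, C_D v g hg, hgx, ← hθ v x hx]
      have hq : q v g x = g := by
        simp only [q, hgx, sg_rep v x hx]; group
      have hr : rep v x = x := hx
      simp only [c', θ, hr, hq]
      group) (by
      intro e x hx
      change C (Φ (n e x)) x₀ = (θ v₀ x₁)⁻¹ * n e x * (θ v₀ x₁)⁻¹⁻¹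
      rw [hΦn e x hx]
      refine (hθedge e x hx).trans ?_
      rw [hθ (S.tgt e) _ (rep_rep _ _), hθ (S.src e) _ (rep_rep _ _), inv_inv])
    rw [injective_iff_map_eq_one]
    intro k hk
    have hk' : k ∈ Ψ.eqLocus (MulAut.conj (θ v₀ x₁)⁻¹).toMonoidHom := by rw [hΨ]; trivial
    have hk'' : C (Φ k) x₀ = (θ v₀ x₁)⁻¹ * k * (θ v₀ x₁)⁻¹⁻¹ := hk'
    have h1 : C 1 x₀ = 1 := by simpa using C_mul 1 1 x₀
    rw [hk, h1] at hk''
    have : k = θ v₀ x₁ * ((θ v₀ x₁)⁻¹ * k * (θ v₀ x₁)⁻¹⁻¹) * (θ v₀ x₁)⁻¹ := by group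
    rw [this, ← hk'']
    group
  · refine le_antisymm ?_ fun h hh => ?_
    · rintro _ ⟨k, rfl⟩
      exact hstab k
    · have hh' : h • x₀ = x₀ := hh
      have hτ₀ : τ v₀ x₀ • x₀ = x₀ := by
        simp only [τ, α, mul_smul, hstab]
        rw [hβ _ _ (rep_rep _ _), sg_smul]
      -- Conjugating by `τ v₀ x₀`, which fixes `x₀`, cancels the coboundary in `hΦC`.
      refine ⟨C (τ v₀ x₀ * h * (τ v₀ x₀)⁻¹) x₀, ?_⟩
      have h1 : (τ v₀ x₀ * h * (τ v₀ x₀)⁻¹) • x₀ = x₀ := by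
        rw [mul_smul, mul_smul, inv_smul_eq_iff.2 hτ₀.symm, hh', hτ₀]
      rw [hΦC, h1]
      group

end GraphDecomposition

/-! ### From graphs of groups to decompositions -/

namespace GraphOfGroups

variable {V E : Type*} (𝒢 : GraphOfGroups V E) (T : Set E) {G : Type*} [Group G]

/-- The stable letter of an edge in the fundamental group. -/
def stableLetter (e : E) : 𝒢.FundamentalGroup T := QuotientGroup.mk' _ (𝒢.t e)

theorem stableLetter_eq_one {e : E} (he : e ∈ T) : 𝒢.stableLetter T e = 1 :=
  (QuotientGroup.eq_one_iff _).2 (Subgroup.subset_normalClosure (Or.inr ⟨e, he, rfl⟩))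

theorem stableLetter_mul_mul_inv (e : E) (x : 𝒢.edgeGroup e) :
    𝒢.stableLetter T e * 𝒢.vertexHom T _ (𝒢.φ₀ e x) * (𝒢.stableLetter T e)⁻¹ =
      𝒢.vertexHom T _ (𝒢.φ₁ e x) := by
  rw [← mul_inv_eq_one]
  exact (QuotientGroup.eq_one_iff _).2 (Subgroup.subset_normalClosure (Or.inl ⟨e, x, rfl⟩))

theorem eq_top_of_mem {M : Subgroup (𝒢.FundamentalGroup T)}
    (hv : ∀ v d, 𝒢.vertexHom T v d ∈ M) (ht : ∀ e, 𝒢.stableLetter T e ∈ M) : M = ⊤ := by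
  rw [eq_top_iff]
  rintro g -
  obtain ⟨w, rfl⟩ := QuotientGroup.mk'_surjective _ g
  induction w using Monoid.Coprod.induction_on with
  | inl m =>
    induction m using Monoid.CoprodI.induction_on with
    | one => simp
    | of i m => exact hv i m
    | mul x y hx hy => simp only [map_mul] at hx hy ⊢; exact mul_mem hx hy
  | inr n =>
    induction n using FreeGroup.induction_on with
    | C1 => simp
    | of e => exact ht e
    | inv_of e h => simp only [map_inv] at h ⊢; exact inv_mem h
    | mul x y hx hy => simp only [map_mul] at hx hy ⊢; exact mul_mem hx hy
  | mul x y hx hy => rw [map_mul]; exact mul_mem hx hy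

/-- The vertex groups, edge groups and stable letters inside a group identified with the
fundamental group. -/
def decomposition {T : Set E} (hT : 𝒢.IsMaximalTree T) (θ : 𝒢.FundamentalGroup T ≃* G) :
    GraphDecomposition G V E where
  src := 𝒢.src
  tgt := 𝒢.tgt
  D v := (θ.toMonoidHom.comp (𝒢.vertexHom T v)).range
  A e := ((θ.toMonoidHom.comp (𝒢.vertexHom T (𝒢.src e))).comp (𝒢.φ₀ e)).range
  t e := θ (𝒢.stableLetter T e)
  T := T
  minimal := hT
  A_le := by
    rintro e _ ⟨x, rfl⟩
    exact ⟨_, rfl⟩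
  conj_mem := by
    rintro e _ ⟨x, rfl⟩
    refine ⟨𝒢.φ₁ e x, ?_⟩
    simp [← stableLetter_mul_mul_inv]
  t_eq_one e he := by rw [𝒢.stableLetter_eq_one T he, map_one]
  closure_eq_top := by
    set M := Subgroup.closure ((⋃ v, ((θ.toMonoidHom.comp (𝒢.vertexHom T v)).range : Set G)) ∪
      Set.range fun e => θ (𝒢.stableLetter T e))
    have h := 𝒢.eq_top_of_mem T (M := M.comap θ.toMonoidHom)
      (fun v d => Subgroup.subset_closure (Or.inl (Set.mem_iUnion.2 ⟨v, d, rfl⟩)))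
      (fun e => Subgroup.subset_closure (Or.inr ⟨e, rfl⟩))
    rw [eq_top_iff]
    rintro g -
    have hg : θ.symm g ∈ M.comap θ.toMonoidHom := by rw [h]; trivial
    simpa using hg

/-- Precomposing with the surjections onto the images `D v` gives maps on the vertex groups
themselves, so injectivity of the vertex groups in the fundamental group is not needed. -/
theorem decomposition_hasLift.{w} {T : Set E} (hT : 𝒢.IsMaximalTree T)
    (θ : 𝒢.FundamentalGroup T ≃* G) :
    GraphDecomposition.HasLift.{w} (𝒢.decomposition hT θ) := by
  intro L _ f s hfs hs
  let F₀ : 𝒢.Generators →* L := Monoid.Coprod.lift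
    (Monoid.CoprodI.lift fun v => (f v).comp (θ.toMonoidHom.comp (𝒢.vertexHom T v)).rangeRestrict)
    (FreeGroup.lift s)
  have hF₀v : ∀ v d, F₀ (𝒢.ofVertex v d) = f v ⟨θ (𝒢.vertexHom T v d), d, rfl⟩ := by
    intro v d
    simp only [F₀, ofVertex, MonoidHom.comp_apply, Monoid.Coprod.lift_apply_inl,
      Monoid.CoprodI.lift_of]
    rfl
  have hF₀t : ∀ e, F₀ (𝒢.t e) = s e := by
    intro e
    simp only [F₀, t, Monoid.Coprod.lift_apply_inr, FreeGroup.lift_apply_of]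
  have hle : Subgroup.normalClosure (𝒢.relators T) ≤ F₀.ker := by
    refine Subgroup.normalClosure_le_normal ?_
    rintro _ (⟨e, x, rfl⟩ | ⟨e, he, rfl⟩)
    · have h := hfs e (θ (𝒢.vertexHom T _ (𝒢.φ₀ e x))) ⟨x, rfl⟩
      simp only [SetLike.mem_coe, MonoidHom.mem_ker, map_mul, map_inv, hF₀v, hF₀t]
      rw [mul_inv_eq_one]
      refine h.trans (congrArg (f (𝒢.tgt e)) (Subtype.ext ?_))
      simp [decomposition, ← stableLetter_mul_mul_inv]
    · simp only [SetLike.mem_coe, MonoidHom.mem_ker, hF₀t]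
      exact hs e he
  let F₁ : 𝒢.FundamentalGroup T →* L := QuotientGroup.lift _ F₀ hle
  refine ⟨F₁.comp θ.symm.toMonoidHom, ?_, ?_⟩
  · rintro v ⟨_, d, rfl⟩
    change F₁ (θ.symm (θ (𝒢.vertexHom T v d))) = _
    rw [MulEquiv.symm_apply_apply]
    exact hF₀v v d
  · intro e
    change F₁ (θ.symm (θ (𝒢.stableLetter T e))) = _
    rw [MulEquiv.symm_apply_apply]
    exact hF₀t e

end GraphOfGroups

/-! ## A finite quotient which is injective on the edge groups -/

theorem Group.ResiduallyFinite.exists_normal_avoiding {H : Type*} [Group H]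
    [Group.ResiduallyFinite H] {s : Set H} (hs : s.Finite) :
    ∃ M : Subgroup H, M.Normal ∧ M.FiniteIndex ∧ ∀ h ∈ M, h ∈ s → h = 1 := by
  induction s, hs using Set.Finite.induction_on with
  | empty => exact ⟨⊤, inferInstance, inferInstance, by simp⟩
  | @insert a s _ _ ih =>
    obtain ⟨M, _, _, hM⟩ := ih
    by_cases ha : a = 1
    · exact ⟨M, ‹_›, ‹_›, by rintro h hh (rfl | hs); exacts [ha, hM h hh hs]⟩
    · obtain ⟨M', hM'⟩ := Group.exists_finiteIndexNormalSubgroup_notMem a ha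
      have := M'.isNormal'
      have := M'.isFiniteIndex'
      refine ⟨M ⊓ M'.toSubgroup, inferInstance, inferInstance, ?_⟩
      rintro h hh (rfl | hs)
      · exact absurd hh.2 hM'
      · exact hM h hh.1 hs

theorem Group.ResiduallyFinite.of_injective {H H' : Type*} [Group H] [Group H']
    [Group.ResiduallyFinite H] {f : H' →* H} (hf : Function.Injective f) :
    Group.ResiduallyFinite H' := by
  rw [Group.residuallyFinite_iff_forall_finiteIndexNormalSubgroup]
  intro g hg
  refine hf ?_
  rw [map_one]
  exact Group.eq_one_iff_forall_finiteIndexNormalSubroup (f g) fun K => hg (K.comap f)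

/-- The translation actions on a finite group along two embeddings of the same group are
isomorphic. -/
theorem exists_perm_intertwining {A W : Type*} [Group A] [Group W] [Finite W] {i j : A →* W}
    (hi : Function.Injective i) (hj : Function.Injective j) :
    ∃ s : Equiv.Perm W, ∀ a w, s (i a * w) = j a * s w := by
  -- The translation action along an embedding is free, so `W` is `A` times a transversal; by
  -- counting, the two transversals have equally many elements.
  have key : ∀ k : A →* W, Function.Injective k →
      ∃ (R : Set W) (ε : A × R ≃ W), ∀ p, ε p = k p.1 * p.2 := by
    intro k hk
    obtain ⟨R, hR, -⟩ := k.range.exists_isComplement_right 1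
    refine ⟨R, ((MonoidHom.ofInjective hk).toEquiv.prodCongr (Equiv.refl R)).trans
      (Equiv.ofBijective _ hR), fun p => rfl⟩
  obtain ⟨R, ε, hε⟩ := key i hi
  obtain ⟨R', ε', hε'⟩ := key j hj
  have : Finite A := Finite.of_injective i hi
  have hcard : Nat.card R = Nat.card R' := by
    have h := (Nat.card_congr ε).trans (Nat.card_congr ε').symm
    rw [Nat.card_prod, Nat.card_prod] at h
    exact Nat.eq_of_mul_eq_mul_left Nat.card_pos h
  let r : R ≃ R' := (Finite.equivFinOfCardEq hcard).trans (Finite.equivFin R').symm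
  refine ⟨ε.symm.trans (((Equiv.refl A).prodCongr r).trans ε'), fun a w => ?_⟩
  obtain ⟨⟨b, c⟩, rfl⟩ := ε.surjective w
  have h : i a * ε (b, c) = ε (a * b, c) := by simp [hε, mul_assoc]
  simp [h, hε', mul_assoc]

namespace GraphDecomposition

/-- `N` is the kernel of an action of `G` on a finite set, assembled from translation actions of
finite quotients of the vertex groups. -/
theorem exists_normal_finiteIndex.{u₁, u₂, u₃} {G : Type u₁} [Group G] {V : Type u₂} {E : Type u₃}
    [Finite V] [Finite E] (S : GraphDecomposition G V E) (hS : HasLift.{max u₁ u₂} S)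
    (hA : ∀ e, Finite (S.A e)) (hres : ∀ v, Group.ResiduallyFinite (S.D v)) :
    ∃ N : Subgroup G, N.Normal ∧ N.FiniteIndex ∧ (∀ e, ∀ a ∈ S.A e, a ∈ N → a = 1) ∧
      ∀ v, Finite (S.D v) → ∀ d ∈ S.D v, d ∈ N → d = 1 := by
  classical
  -- The elements to be detected: both embedded copies of each edge group, and all of `D v` when it
  -- is finite.
  let B : V → Set G := fun v => ((⋃ e, (S.A e : Set G)) ∪
    ⋃ e, (fun a => S.t e * a * (S.t e)⁻¹) '' (S.A e : Set G)) ∪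
    if Finite (S.D v) then (S.D v : Set G) else ∅
  have hB : ∀ v, (B v).Finite := by
    intro v
    refine ((Set.finite_iUnion fun e => Set.toFinite _).union
      (Set.finite_iUnion fun e => (Set.toFinite _).image _)).union ?_
    split_ifs with h
    · exact Set.toFinite _
    · exact Set.finite_empty
  have hM : ∀ v, ∃ M : Subgroup (S.D v), M.Normal ∧ M.FiniteIndex ∧
      ∀ d ∈ M, (d : G) ∈ B v → d = 1 := fun v =>
    Group.ResiduallyFinite.exists_normal_avoiding ((hB v).preimage Subtype.val_injective.injOn)
  choose M hMn hMf hM using hM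
  -- A single set on which all vertex groups act by translation, so that actions of different vertex
  -- groups can be compared.
  let W := ∀ v, S.D v ⧸ M v
  let j : ∀ v, S.D v →* W := fun v =>
    (MonoidHom.mulSingle (fun v => S.D v ⧸ M v) v).comp (QuotientGroup.mk' (M v))
  have hj : ∀ v d, j v d = 1 → d ∈ M v := by
    intro v d h
    have h' : Pi.mulSingle (M := fun v => S.D v ⧸ M v) v (QuotientGroup.mk' (M v) d) v = 1 :=
      congrFun h v
    rw [Pi.mulSingle_eq_same] at h'
    exact (QuotientGroup.eq_one_iff d).1 h'
  have hs : ∀ e, ∃ s : Equiv.Perm W, ∀ a (ha : a ∈ S.A e) w,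
      s (j _ ⟨a, S.A_le e ha⟩ * w) = j _ ⟨_, S.conj_mem ha⟩ * s w := by
    intro e
    let κ : S.A e →* S.D (S.tgt e) := MonoidHom.mk' (fun a => ⟨_, S.conj_mem a.2⟩) fun a b =>
      Subtype.ext (by simp)
    obtain ⟨s, hs⟩ := exists_perm_intertwining
      (i := (j (S.src e)).comp (Subgroup.inclusion (S.A_le e))) (j := (j (S.tgt e)).comp κ)
      ((injective_iff_map_eq_one _).2 fun a h => by
        have := hM _ _ (hj _ _ h) (Or.inl (Or.inl (Set.mem_iUnion.2 ⟨e, a.2⟩)))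
        have h1 : (a : G) = 1 := congrArg (Subtype.val) this
        exact Subtype.ext h1)
      ((injective_iff_map_eq_one _).2 fun a h => by
        have := hM _ _ (hj _ _ h) (Or.inl (Or.inr (Set.mem_iUnion.2 ⟨e, a, a.2, rfl⟩)))
        have h1 : S.t e * a * (S.t e)⁻¹ = 1 := congrArg (Subtype.val) this
        exact Subtype.ext (by simpa using h1))
    exact ⟨s, fun a ha w => hs ⟨a, ha⟩ w⟩
  choose s hs using hs
  -- The intertwiners `s e` have to become trivial on the tree; conjugating the action of `D v` by
  -- `p v` achieves this.
  obtain ⟨p, hp⟩ := Multigraph.exists_potential S.minimal s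
  let ρ : W →* Equiv.Perm W := MulAction.toPermHom W W
  obtain ⟨F, hF, -⟩ := hS (Equiv.Perm W)
    (fun v => (MulAut.conj (p v)⁻¹).toMonoidHom.comp (ρ.comp (j v)))
    (fun e => (p (S.tgt e))⁻¹ * s e * p (S.src e)) (by
      intro e a ha
      have h : s e * ρ (j _ ⟨a, S.A_le e ha⟩) = ρ (j _ ⟨_, S.conj_mem ha⟩) * s e :=
        Equiv.ext fun w => hs e a ha w
      have h' : ρ (j _ ⟨_, S.conj_mem ha⟩) = s e * ρ (j _ ⟨a, S.A_le e ha⟩) * (s e)⁻¹ := by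
        rw [h, mul_inv_cancel_right]
      simp only [MonoidHom.comp_apply, MulEquiv.toMonoidHom_eq_coe, MonoidHom.coe_coe,
        MulAut.conj_apply, h']
      group) (by
      intro e he
      rw [hp e he]
      group)
  have hker : ∀ v d (hd : d ∈ S.D v), d ∈ F.ker → ⟨d, hd⟩ ∈ M v := by
    intro v d hd h
    rw [MonoidHom.mem_ker, hF v ⟨d, hd⟩] at h
    simp only [MonoidHom.comp_apply, MulEquiv.toMonoidHom_eq_coe, MonoidHom.coe_coe,
      EmbeddingLike.map_eq_one_iff] at h
    refine hj _ _ ?_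
    have := Equiv.congr_fun h 1
    simpa [ρ] using this
  refine ⟨F.ker, inferInstance, inferInstance, ?_, ?_⟩
  · intro e a ha h
    exact congrArg Subtype.val (hM _ _ (hker _ a (S.A_le e ha) h)
      (Or.inl (Or.inl (Set.mem_iUnion.2 ⟨e, ha⟩))))
  · intro v hv d hd h
    refine congrArg Subtype.val (hM _ _ (hker _ d hd h) (Or.inr ?_))
    rw [if_pos hv]
    exact hd

end GraphDecomposition

/-! ### Assembling the free product -/

theorem mem_of_smul_quotient_eq {G : Type*} [Group G] {N : Subgroup G} [N.Normal] {g : G}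
    {x : G ⧸ N} (h : g • x = x) : g ∈ N := by
  induction x using QuotientGroup.induction_on with
  | H k =>
    have h' : ((g * k : G) : G ⧸ N) = (k : G ⧸ N) := h
    rw [QuotientGroup.mk_mul, mul_eq_right] at h'
    exact (QuotientGroup.eq_one_iff g).1 h'

section FreeProductMap

variable {G : Type*} [Group G] {r n : ℕ} (x : Fin r → G) (P : Fin n → Subgroup G)
  (Q : ∀ i, Subgroup (P i)) (g : Fin n → G)

theorem freeProductMap_inl_of (k : Fin r) :
    freeProductMap x P Q g (Monoid.Coprod.inl (FreeGroup.of k)) = x k := by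
  simp [freeProductMap]

theorem freeProductMap_inr_of (i : Fin n) (q : Q i) :
    freeProductMap x P Q g (Monoid.Coprod.inr (Monoid.CoprodI.of (M := fun i => Q i) q)) =
      g i * q * (g i)⁻¹ := by
  simp [freeProductMap]

end FreeProductMap

namespace GraphDecomposition

/-- A group with a graph of groups decomposition, whose edge groups are finite and whose vertex
groups are finite or conjugate to residually finite subgroups in `Ps`, is virtually the free product
of a free group and of finite index subgroups of members of `Ps`. -/
theorem exists_freeProduct.{u₁, u₂, u₃} {G : Type u₁} [Group G] {V : Type u₂} {E : Type u₃}
    [Finite V] [Nonempty V] [Finite E]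
    (S : GraphDecomposition G V E)
    (hS₁ : HasLift.{max u₁ u₂} S) (hS₂ : HasLift.{u₁} S) (Ps : Set (Subgroup G))
    (hA : ∀ e, Finite (S.A e))
    (hD : ∀ v, Finite (S.D v) ∨ ∃ P ∈ Ps, ∃ g : G, S.D v = P.map (MulAut.conj g).toMonoidHom)
    (hres : ∀ P ∈ Ps, Group.ResiduallyFinite P) :
    ∃ H : Subgroup G, H.FiniteIndex ∧
      ∃ (r n : ℕ) (x : Fin r → G) (P : Fin n → Subgroup G) (Q : ∀ i, Subgroup (P i))
        (g : Fin n → G),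
        (∀ i, P i ∈ Ps ∧ (Q i).FiniteIndex) ∧
        Function.Injective (freeProductMap x P Q g) ∧
        (freeProductMap x P Q g).range = H := by
  classical
  have hresD : ∀ v, Group.ResiduallyFinite (S.D v) := by
    intro v
    rcases hD v with h | ⟨P, hP, g, hg⟩
    · infer_instance
    · have := hres P hP
      rw [hg]
      exact .of_injective (f := (P.equivMapOfInjective _
        (MulAut.conj g).injective).symm.toMonoidHom) (MulEquiv.injective _)
  obtain ⟨N, hN, hNf, hNA, hND⟩ := S.exists_normal_finiteIndex hS₁ hA hresD
  let X := G ⧸ N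
  have hfree : ∀ e, ∀ a ∈ S.A e, ∀ x : X, a • x = x → a = 1 := fun e a ha x hx =>
    hNA e a ha (mem_of_smul_quotient_eq hx)
  have hfin : ∀ v, Finite (S.D v) → ∀ d ∈ S.D v, ∀ x : X, d • x = x → d = 1 :=
    fun v hv d hd x hx => hND v hv d hd (mem_of_smul_quotient_eq hx)
  obtain ⟨T', β, x₀, hβ, hβT, hconn⟩ := S.exists_quotient_tree (X := X)
  have hP : ∀ v, ∃ (P : Subgroup G) (γ : G), ¬ Finite (S.D v) →
      P ∈ Ps ∧ S.D v = P.map (MulAut.conj γ).toMonoidHom := by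
    intro v
    rcases hD v with h | ⟨P, hP, γ, hγ⟩
    · exact ⟨⊥, 1, fun h' => absurd h h'⟩
    · exact ⟨P, γ, fun _ => ⟨hP, hγ⟩⟩
  choose P' γ hP' using hP
  -- Free factors are indexed by vertices of the quotient graph over infinite `D v`, those over
  -- finite ones having trivial stabilizers; free generators by its edges outside the maximal tree.
  let J := {y : V × X // ¬ Finite (S.D y.1) ∧ orbitRep (S.D y.1) y.2 = y.2}
  let I := {y : E × X // orbitRep (S.A y.1) y.2 = y.2 ∧ y ∉ T'}
  let eJ : Fin (Nat.card J) ≃ J := (Finite.equivFin J).symm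
  let eI : Fin (Nat.card I) ≃ I := (Finite.equivFin I).symm
  let ξ : E → X → G := fun e x =>
    (β (S.tgt e) (orbitRep (S.D (S.tgt e)) (S.t e • x)))⁻¹ * S.edgeElement e x *
        β (S.src e) (orbitRep (S.D (S.src e)) x)
  let x : Fin (Nat.card I) → G := fun k => ξ (eI k).1.1 (eI k).1.2
  let P : Fin (Nat.card J) → Subgroup G := fun i => P' (eJ i).1.1
  -- Conjugation by `γ⁻¹` carries `D v` to `P i` and the stabilizer of a point `y` to that of `γ⁻¹ •
  -- y`. It has finite index because `X` is finite.
  let Q : ∀ i, Subgroup (P i) := fun i =>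
    (MulAction.stabilizer G ((γ (eJ i).1.1)⁻¹ • (eJ i).1.2)).subgroupOf (P i)
  let g : Fin (Nat.card J) → G := fun i => (β (eJ i).1.1 (eJ i).1.2)⁻¹ * γ (eJ i).1.1
  have hstabfin : ∀ y : X, (MulAction.stabilizer G y).FiniteIndex := by
    intro y
    have := Finite.of_equiv _ (MulAction.orbitEquivQuotientStabilizer G y)
    exact Subgroup.finiteIndex_of_finite_quotient
  let L : Fin (Nat.card J) → Subgroup G := fun i =>
    S.D (eJ i).1.1 ⊓ MulAction.stabilizer G (eJ i).1.2
  have hmem : ∀ i d, d ∈ S.D (eJ i).1.1 ↔ (γ (eJ i).1.1)⁻¹ * d * γ (eJ i).1.1 ∈ P i := by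
    intro i d
    rw [(hP' _ (eJ i).2.1).2, Subgroup.mem_map]
    constructor
    · rintro ⟨q, hq, rfl⟩
      simpa [mul_assoc] using hq
    · intro h
      exact ⟨_, h, by simp [mul_assoc]⟩
  have hmem' : ∀ i d, d • (eJ i).1.2 = (eJ i).1.2 ↔
      ((γ (eJ i).1.1)⁻¹ * d * γ (eJ i).1.1) • (γ (eJ i).1.1)⁻¹ • (eJ i).1.2 =
        (γ (eJ i).1.1)⁻¹ • (eJ i).1.2 := by
    intro i d
    simp [mul_smul]
  let κ : ∀ i, L i →* Q i := fun i => MonoidHom.mk'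
    (fun d => ⟨⟨(γ (eJ i).1.1)⁻¹ * d * γ (eJ i).1.1, (hmem i d).1 d.2.1⟩, (hmem' i d).1 d.2.2⟩)
    fun d d' => Subtype.ext (Subtype.ext (by simp [mul_assoc]))
  have hκ : ∀ i q, ∃ d, κ i d = q := by
    rintro i ⟨⟨q, hq⟩, hq'⟩
    have h : (γ (eJ i).1.1)⁻¹ * (γ (eJ i).1.1 * q * (γ (eJ i).1.1)⁻¹) * γ (eJ i).1.1 = q := by
      group
    exact ⟨⟨γ (eJ i).1.1 * q * (γ (eJ i).1.1)⁻¹, (hmem i _).2 (by rwa [h]),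
      (hmem' i _).2 (by rw [h]; exact hq')⟩, Subtype.ext (Subtype.ext h)⟩
  let K := Monoid.Coprod (FreeGroup (Fin (Nat.card I))) (Monoid.CoprodI fun i => Q i)
  let F : Fin (Nat.card J) → G → K := fun i d =>
    if h : d ∈ L i then Monoid.Coprod.inr (Monoid.CoprodI.of (M := fun i => Q i) (κ i ⟨d, h⟩)) else 1
  have hF : ∀ i d (h : d ∈ L i), F i d = Monoid.Coprod.inr (Monoid.CoprodI.of (M := fun i => Q i) (κ i ⟨d, h⟩)) :=
    fun i d h => dif_pos h
  let f : V → X → G → K := fun v y d =>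
    if h : ¬ Finite (S.D v) ∧ orbitRep (S.D v) y = y then F (eJ.symm ⟨(v, y), h⟩) d else 1
  have hf : ∀ i d, f (eJ i).1.1 (eJ i).1.2 d = F i d := by
    intro i d
    have h : eJ.symm ⟨((eJ i).1.1, (eJ i).1.2), (eJ i).2⟩ = i := eJ.symm_apply_apply i
    simp only [f, dif_pos (eJ i).2, h]
  have hf_fin : ∀ v y d, Finite (S.D v) → f v y d = 1 :=
    fun v y d h => dif_neg fun h' => h'.1 h
  have hJ : ∀ v y, ¬ Finite (S.D v) → orbitRep (S.D v) y = y →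
      ∃ i, v = (eJ i).1.1 ∧ y = (eJ i).1.2 := by
    intro v y hv hy
    obtain ⟨i, hi⟩ := eJ.surjective ⟨(v, y), hv, hy⟩
    exact ⟨i, by rw [hi], by rw [hi]⟩
  let n : E → X → K := fun e y =>
    if h : orbitRep (S.A e) y = y ∧ (e, y) ∉ T' then
      Monoid.Coprod.inl (FreeGroup.of (eI.symm ⟨(e, y), h⟩)) else 1
  let Φ : K →* G := freeProductMap x P Q g
  have hΦn : ∀ k, Φ (Monoid.Coprod.inl (FreeGroup.of k)) = x k :=
    freeProductMap_inl_of x P Q g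
  have hΦF : ∀ i d, d ∈ L i →
      Φ (F i d) = (β (eJ i).1.1 (eJ i).1.2)⁻¹ * d * β (eJ i).1.1 (eJ i).1.2 := by
    intro i d hd
    rw [hF i d hd]
    refine (freeProductMap_inr_of x P Q g i _).trans ?_
    change g i * ((γ (eJ i).1.1)⁻¹ * d * γ (eJ i).1.1) * (g i)⁻¹ = _
    simp only [g]
    group
  obtain ⟨hinj, hrange⟩ := S.injective_and_range_eq_stabilizer hS₂ hfree hβ hβT hconn f n Φ
    (by
      intro v y hy d hd hdy d' hd' hdy'
      by_cases hv : Finite (S.D v)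
      · simp only [hf_fin v _ _ hv, mul_one]
      · obtain ⟨i, rfl, rfl⟩ := hJ v y hv hy
        have h : d ∈ L i := ⟨hd, hdy⟩
        have h' : d' ∈ L i := ⟨hd', hdy'⟩
        rw [hf, hf, hf, hF i d h, hF i d' h', hF i _ (mul_mem h h'), ← map_mul, ← map_mul,
          ← map_mul]
        rfl)
    (by
      intro v y hy d hd hdy
      by_cases hv : Finite (S.D v)
      · rw [hf_fin v _ _ hv, hfin v hv d hd y hdy]
        simp
      · obtain ⟨i, rfl, rfl⟩ := hJ v y hv hy
        rw [hf]
        exact hΦF i d ⟨hd, hdy⟩)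
    (by
      intro e y hy
      by_cases h : (e, y) ∈ T'
      · simp only [n, h, not_true_eq_false, and_false, dif_neg, not_false_eq_true, map_one]
        rw [hβT e y h]
        group
      · simp only [n, dif_pos (And.intro hy h), hΦn, x, Equiv.apply_symm_apply, ξ])
    (by
      intro e y h
      simp only [n, h, not_true_eq_false, and_false, dif_neg, not_false_eq_true])
    (by
      intro M hMf hMn
      rw [eq_top_iff]
      rintro k -
      induction k using Monoid.Coprod.induction_on with
      | inl m =>
        induction m using FreeGroup.induction_on with
        | C1 => simp
        | of k =>
          have h := hMn (eI k).1.1 (eI k).1.2 (eI k).2.1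
          have hk : eI.symm ⟨((eI k).1.1, (eI k).1.2), (eI k).2⟩ = k := eI.symm_apply_apply k
          simp only [n, dif_pos (eI k).2, hk] at h
          exact h
        | inv_of k h => rw [map_inv]; exact inv_mem h
        | mul a b ha hb => rw [map_mul]; exact mul_mem ha hb
      | inr m =>
        induction m using Monoid.CoprodI.induction_on with
        | one => simp
        | of i q =>
          obtain ⟨d, rfl⟩ := hκ i q
          have h := hMf (eJ i).1.1 (eJ i).1.2 (eJ i).2.2 d d.2.1 d.2.2
          rw [hf, hF i d d.2] at h
          exact h
        | mul a b ha hb => rw [map_mul]; exact mul_mem ha hb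
      | mul a b ha hb => exact mul_mem ha hb)
  refine ⟨MulAction.stabilizer G x₀, hstabfin x₀, _, _, x, P, Q, g,
    fun i => ⟨(hP' _ (eJ i).2.1).1, ?_⟩, hinj, hrange⟩
  have := hstabfin ((γ (eJ i).1.1)⁻¹ • (eJ i).1.2)
  infer_instance

end GraphDecomposition

theorem mainTheorem7 {G : Type*} [Group G] (Ps : Set (Subgroup G))
    (hG : RelHyp.IsRelativelyHyperbolic G Ps)
    {V E : Type*} [Finite V] [Nonempty V] [Finite E] (𝒢 : GraphOfGroups V E)
    (T : Set E) (hT : 𝒢.IsMaximalTree T) (θ : 𝒢.FundamentalGroup T ≃* G)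
    (hedge : ∀ e, Finite (𝒢.edgeGroup e))
    (hvertex : ∀ v, Finite (𝒢.vertexGroup v) ∨ ∃ P ∈ Ps, ∃ g : G,
      (θ.toMonoidHom.comp (𝒢.vertexHom T v)).range = P.map (MulAut.conj g).toMonoidHom)
    (hres : ∀ P ∈ Ps, Group.ResiduallyFinite P) :
    ∃ H : Subgroup G, H.FiniteIndex ∧
      ∃ (r n : ℕ) (x : Fin r → G) (P : Fin n → Subgroup G) (Q : ∀ i, Subgroup (P i))
        (g : Fin n → G),
        (∀ i, P i ∈ Ps ∧ (Q i).FiniteIndex) ∧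
        Function.Injective (freeProductMap x P Q g) ∧
        (freeProductMap x P Q g).range = H := by
  refine (𝒢.decomposition hT θ).exists_freeProduct (𝒢.decomposition_hasLift hT θ)
    (𝒢.decomposition_hasLift hT θ) Ps ?_ ?_ hres
  · intro e
    have := hedge e
    exact Set.finite_range _
  · intro v
    refine (hvertex v).imp_left fun h => ?_
    have := h
    exact Set.finite_range _
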